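/- **Setting.** Let $G=(\mathcal V,\mathcal E)$ be a finite connected simple graph; write $i - j$ for $(i,j)\in\mathcal E$ and $\mathcal E(i)=\{j: i - j\}$. Let $\mathcal S$ be the finite set of lists of preferences $\sigma=(\sigma(i))_{i\in\mathcal V}$, where $\sigma(i)$ is a permutation of $\mathcal E(i)$. Let $\mathbb W$ be the set of finite words over $\mathcal V$ in which no two adjacent classes both occur, $\mathbb W_2$ the set of words of even length in $\mathbb W$, $|w|$ the length of $w$, and $\emptyset$ the empty word. An *admissible matching policy* $\phi$ consists of a probability distribution $\nu_\phi$ on $\mathcal S$ and a rule that, for every $w\in\mathbb W$, $v\in\mathcal V$, $\sigma\in\mathcal S$ such that some letter of $w$ is in $\mathcal E(v)$, selects a position of $w$ whose letter is in $\mathcal E(v)$. Let $w\odot_\phi(v,\sigma)$ be $w$ with the selected letter deleted if such a letter exists, and $wv$ otherwise. For $z=z_1\cdots z_q\in\mathcal V^*$ and $\varsigma=\varsigma_1\cdots\varsigma_q\in\mathcal S^*$ let $Q_\phi(z,\varsigma)=(\cdots(\emptyset\odot_\phi(z_1,\varsigma_1))\cdots)\odot_\phi(z_q,\varsigma_q)$.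 Below, all words $\varsigma,\varsigma',\varsigma''\in\mathcal S^*$ have their letters in the support of $\nu_\phi$. The policy $\phi$ is *sub-additive* if $|Q_\phi(z'z'',\varsigma'\varsigma'')|\le|Q_\phi(z',\varsigma')|+|Q_\phi(z'',\varsigma'')|$ for all $z',z''\in\mathcal V^*$ and all $\varsigma',\varsigma''$ with $|\varsigma'|=|z'|$, $|\varsigma''|=|z''|$. A word $z\in\mathcal V^*$ of even length $2p$ is a *strong erasing word* if (1) $Q_\phi(ijz,\varsigma\varsigma')=\emptyset$ for all non-adjacent $i,j\in\mathcal V$ (including $i=j$) and all $\varsigma,\varsigma'$ of lengths $2$ and $2p$; and (2) $Q_\phi(z_{2\ell+1}\cdots z_{2p},\varsigma'_{2\ell+1}\cdots\varsigma'_{2p})=\emptyset$ for all $0\le\ell\le p-1$ and all $\varsigma'$ of length $2p$. Let $(V_n,\Sigma_n)_{n\in\mathbb Z}$ be random variables in $\mathcal V\times\mathcal S$ satisfying (H1$'$) the sequence $(V_{2n},\Sigma_{2n},V_{2n+1},\Sigma_{2n+1})_{n\in\mathbb Z}$ is stationary and ergodic; for all $n$, $V_{2n}$ has law $\mu^0$,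 $V_{2n+1}$ has law $\mu^1$, and $\Sigma_{2n},\Sigma_{2n+1}$ have law $\nu_\phi$; and $(\mu^0+\mu^1)/2$ has full support $\mathcal V$. Let $\mathbf P$ be the law of this paired sequence on $\Omega^0=(\mathcal V\times\mathcal S\times\mathcal V\times\mathcal S)^{\mathbb Z}$ with the product $\sigma$-field, $\theta$ the shift $(\theta\omega)_n=\omega_{n+1}$, and $(V^0,\Sigma^0,V^1,\Sigma^1)$ the $0$-th coordinate. For a $\mathbb W_2$-valued random variable $Y$ on $\Omega^0$ define $$U^{[Y]}_0=Y,\qquad U^{[Y]}_{n+1}=\bigl(U^{[Y]}_n\odot_\phi(V^0\circ\theta^n,\Sigma^0\circ\theta^n)\bigr)\odot_\phi(V^1\circ\theta^n,\Sigma^1\circ\theta^n),\quad n\ge0.$$ Let $\mathscr A_n(\emptyset)=\{U^{[\emptyset]}_n=\emptyset\}$ and, for words $z^1,\dots,z^r$ of even length with $m=\sum_i|z^i|/2$, let $$\mathscr B^r(z^1,\dots,z^r)=\{V^0\,V^1\,(V^0\circ\theta)(V^1\circ\theta)\cdots(V^0\circ\theta^{m-1})(V^1\circ\theta^{m-1})=z^1z^2\cdots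 z^r\}.$$ **Theorem.** Assume (H1$'$), that $\phi$ is sub-additive, that a strong erasing word for $(G,\phi)$ exists, and that for every integer $r\ge1$ there are (possibly identical) strong erasing words $z^1,\dots,z^r$ for $(G,\phi)$ with $$\lim_{n\to\infty}\mathbf P\Bigl[\bigcap_{k=0}^\infty\bigcup_{l=0}^n \mathscr A_l(\emptyset)\cap\theta^k\mathscr A_{l+k}(\emptyset)\cap\theta^{-l}\mathscr B^r(z^1,\dots,z^r)\Bigr]=1.$$ Then there is a $\mathbb W_2$-valued random variable $U$ on $\Omega^0$ solving $$U\circ\theta=\bigl(U\odot_\phi(V^0,\Sigma^0)\bigr)\odot_\phi(V^1,\Sigma^1)\qquad\mathbf P\text{-a.s.}$$ such that 1. $U$ is the unique solution: every $\mathbb W_2$-valued random variable $U'$ solving this equation (in particular every almost surely bounded one) satisfies $U'=U$ $\mathbf P$-a.s.; 2. for every $\mathbb W_2$-valued random variable $Y$ on $\Omega^0$ such that, for some $r\ge 1$, $|Y|\le 2r$ $\mathbf P$-a.s., the sequence $(U^{[Y]}_n)$ converges to $U$ with strong backwards coupling: $\mathbf P$-a.s. there is $N^*\ge0$ such that $U^{[Y]}_n\circ\theta^{-n}=U$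 for all $n\ge N^*$. -/

import Mathlib

open MeasureTheory Filter Topology

noncomputable section

namespace MatchingModel

variable {V : Type*}

/-- Admissible queue details: words over `V` in which no two compatible classes both occur. -/
def Queue (G : SimpleGraph V) : Type _ :=
  {w : List V // ∀ i j, G.Adj i j → ¬ (i ∈ w ∧ j ∈ w)}

/-- Lists of preferences: for every class `i`, a permutation of the classes compatible with `i`. -/
def Prefs (G : SimpleGraph V) : Type _ :=
  ∀ i : V, Equiv.Perm (G.neighborSet i)

instance (G : SimpleGraph V) : MeasurableSpace (Queue G) := ⊤

instance (G : SimpleGraph V) : MeasurableSpace (Prefs G) := ⊤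

variable {G : SimpleGraph V}

/-- The length of a queue detail. -/
def Queue.length (w : Queue G) : ℕ := w.1.length

/-- The empty queue detail. -/
def Queue.empty (G : SimpleGraph V) : Queue G := ⟨[], by simp⟩

/-- The queue details of even length. -/
def evenQueues (G : SimpleGraph V) : Set (Queue G) := {w | Even w.length}

/-- An admissible matching policy: the position in the buffer of the match of an incoming item is
a function of the queue detail, of the class of the item and of its list of preferences only
(`pos` is irrelevant when no compatible item is present). The policy comes with the distribution
from which the lists of preferences are drawn. -/
structure MatchingPolicy (G : SimpleGraph V) where
  pos : Queue G → V → Prefs G → ℕ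
  pos_spec : ∀ (w : Queue G) (v : V) (σ : Prefs G), (∃ j ∈ w.1, G.Adj v j) →
    ∃ h : pos w v σ < w.1.length, G.Adj v (w.1[pos w v σ]'h)
  prefLaw : PMF (Prefs G)

theorem append_admissible (w : Queue G) (v : V) (h : ¬ ∃ j ∈ w.1, G.Adj v j) :
    ∀ i j, G.Adj i j → ¬ (i ∈ w.1 ++ [v] ∧ j ∈ w.1 ++ [v]) := by
  rintro i j hij ⟨hi, hj⟩
  simp only [List.mem_append, List.mem_singleton] at hi hj
  rcases hi with hi | rfl
  · rcases hj with hj | rfl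
    · exact w.2 i j hij ⟨hi, hj⟩
    · exact h ⟨i, hi, hij.symm⟩
  · rcases hj with hj | rfl
    · exact h ⟨j, hj, hij⟩
    · exact G.irrefl hij

theorem erase_admissible (w : Queue G) (k : ℕ) :
    ∀ i j, G.Adj i j → ¬ (i ∈ w.1.eraseIdx k ∧ j ∈ w.1.eraseIdx k) :=
  fun i j hij h => w.2 i j hij ⟨List.mem_of_mem_eraseIdx h.1, List.mem_of_mem_eraseIdx h.2⟩

namespace MatchingPolicy

variable (φ : MatchingPolicy G)

open Classical in
/-- The queue detail after the arrival of an item of class `v` with list of preferences `σ`: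
the item is matched with (and so removes) the item chosen by the policy if a compatible item is
present, and is put at the end of the queue otherwise. -/
def odot (w : Queue G) (v : V) (σ : Prefs G) : Queue G :=
  if h : ∃ j ∈ w.1, G.Adj v j then ⟨w.1.eraseIdx (φ.pos w v σ), erase_admissible w _⟩
  else ⟨w.1 ++ [v], append_admissible w v h⟩

/-- `Q z ς` is the queue detail after the arrivals of the word `z` with the word `ς` (of the same
length) of lists of preferences, in a system that is initially empty. -/
def Q (z : List V) (ς : List (Prefs G)) : Queue G :=
  (z.zip ς).foldl (fun w p => φ.odot w p.1 p.2) (Queue.empty G)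

/-- All letters of the word `ς` can possibly be drawn from the preference distribution. -/
def Drawable (ς : List (Prefs G)) : Prop := ∀ σ ∈ ς, σ ∈ φ.prefLaw.support

/-- Sub-additive policies. -/
def SubAdditive : Prop :=
  ∀ (z' z'' : List V) (ς' ς'' : List (Prefs G)), φ.Drawable ς' → φ.Drawable ς'' →
    ς'.length = z'.length → ς''.length = z''.length →
    (φ.Q (z' ++ z'') (ς' ++ ς'')).length ≤ (φ.Q z' ς').length + (φ.Q z'' ς'').length

/-- Strong erasing words for `(G, φ)`. -/
def StrongErasing (z : List V) : Prop :=
  Even z.length ∧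
  (∀ i j : V, ¬ G.Adj i j → ∀ ς ς' : List (Prefs G), φ.Drawable ς → φ.Drawable ς' →
    ς.length = 2 → ς'.length = z.length → φ.Q ([i, j] ++ z) (ς ++ ς') = Queue.empty G) ∧
  (∀ l : ℕ, 2 * l < z.length → ∀ ς' : List (Prefs G), φ.Drawable ς' →
    ς'.length = z.length → φ.Q (z.drop (2 * l)) (ς'.drop (2 * l)) = Queue.empty G)

end MatchingPolicy

/-! The canonical space of the input at even times. -/

/-- The input at one (even) time: `(V⁰, Σ⁰, V¹, Σ¹)`. -/
abbrev PairInput (G : SimpleGraph V) : Type _ := V × Prefs G × V × Prefs G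

/-- The canonical space of bi-infinite sequences of paired inputs. With a measurable space on `V`
it carries the product sigma-field. -/
abbrev PalmSpace (G : SimpleGraph V) : Type _ := ℤ → PairInput G

/-- The bijective shift `(ω n) ↦ (ω (n + 1))`. -/
def shift (G : SimpleGraph V) : Equiv.Perm (PalmSpace G) where
  toFun ω n := ω (n + 1)
  invFun ω n := ω (n - 1)
  left_inv ω := by funext n; simp
  right_inv ω := by funext n; simp

/-- The sequence of paired inputs `(V (2n), Σ (2n), V (2n+1), Σ (2n+1))`, `n ∈ ℤ`. -/
def pairInput {Ω : Type*} (C : ℤ → Ω → V) (S : ℤ → Ω → Prefs G) (ω : Ω) : PalmSpace G :=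
  fun n => (C (2 * n) ω, S (2 * n) ω, C (2 * n + 1) ω, S (2 * n + 1) ω)

/-- The image probability measure of the paired input sequence on the canonical space. -/
def palmLaw [MeasurableSpace V] {Ω : Type*} [MeasurableSpace Ω] (P : Measure Ω)
    (C : ℤ → Ω → V) (S : ℤ → Ω → Prefs G) : Measure (PalmSpace G) :=
  P.map (pairInput C S)

/-- The paired input sequence is stationary and ergodic, the class marginals are `μ₀` and `μ₁`,
the preference marginals are the preference distribution of `φ`, and `(μ₀ + μ₁) / 2` has full
support. -/
structure StationaryErgodicInput [MeasurableSpace V] {Ω : Type*} [MeasurableSpace Ω]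
    (P : Measure Ω) (φ : MatchingPolicy G) (μ₀ μ₁ : PMF V)
    (C : ℤ → Ω → V) (S : ℤ → Ω → Prefs G) : Prop where
  measurable_class : ∀ n, Measurable (C n)
  measurable_pref : ∀ n, Measurable (S n)
  ergodic : Ergodic (shift G) (palmLaw P C S)
  law_class_even : ∀ n : ℤ, P.map (C (2 * n)) = μ₀.toMeasure
  law_class_odd : ∀ n : ℤ, P.map (C (2 * n + 1)) = μ₁.toMeasure
  law_pref : ∀ n : ℤ, P.map (S n) = φ.prefLaw.toMeasure
  full_support : ∀ v : V, (μ₀ v + μ₁ v) / 2 ≠ 0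

/-- The even buffer content after the paired input `x`, from the even buffer content `w`. -/
def evenStep (φ : MatchingPolicy G) (w : Queue G) (x : PairInput G) : Queue G :=
  φ.odot (φ.odot w x.1 x.2.1) x.2.2.1 x.2.2.2

/-- The sequence `U^[Y]` of even buffer contents, with the value `Y` at time `0`. -/
def evenContent (φ : MatchingPolicy G) (Y : PalmSpace G → Queue G) :
    ℕ → PalmSpace G → Queue G
  | 0, ω => Y ω
  | n + 1, ω => evenStep φ (evenContent φ Y n ω) (((shift G) ^ n) ω 0)

/-- Random variables with values in the queue details of even length. -/
def IsEvenRV [MeasurableSpace V] (Y : PalmSpace G → Queue G) : Prop :=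
  Measurable Y ∧ ∀ ω, Y ω ∈ evenQueues G

/-- Almost surely bounded random variables with values in the queue details of even length. -/
def IsBoundedEvenRV [MeasurableSpace V] (P₀ : Measure (PalmSpace G))
    (Y : PalmSpace G → Queue G) : Prop :=
  IsEvenRV Y ∧ ∃ r : ℕ, 1 ≤ r ∧ ∀ᵐ ω ∂P₀, (Y ω).length ≤ 2 * r

/-- Solutions of the stationary recursion `U ∘ θ = (U ⊙ (V⁰, Σ⁰)) ⊙ (V¹, Σ¹)`, almost surely. -/
def IsStationarySolution [MeasurableSpace V] (P₀ : Measure (PalmSpace G))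
    (φ : MatchingPolicy G) (U : PalmSpace G → Queue G) : Prop :=
  IsEvenRV U ∧ ∀ᵐ ω ∂P₀, U (shift G ω) = evenStep φ (U ω) (ω 0)

/-- Strong backwards coupling of `U^[Y]` with the stationary sequence `U ∘ θⁿ`: almost surely, for
all large `n`, the content at time `0` started from `Y` at time `-n` is `U`. -/
def StrongBackwardsCoupling [MeasurableSpace V] (P₀ : Measure (PalmSpace G))
    (φ : MatchingPolicy G) (Y U : PalmSpace G → Queue G) : Prop :=
  ∀ᵐ ω ∂P₀, ∃ N : ℕ, ∀ n ≥ N, evenContent φ Y n (((shift G) ^ n).symm ω) = U ω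

/-- The event `A_n(∅)` that the system started empty at time `0` is empty at (even) time `n`. -/
def emptyEvent (φ : MatchingPolicy G) (n : ℕ) : Set (PalmSpace G) :=
  {ω | evenContent φ (fun _ => Queue.empty G) n ω = Queue.empty G}

/-- The event that the arrivals of the times `0, …, m - 1`, where `2 m` is the total length of the
words `z i` (of even length), spell the concatenation of these words. -/
def wordEvent (G : SimpleGraph V) {r : ℕ} (z : Fin r → List V) : Set (PalmSpace G) :=
  {ω | (List.range (∑ i, (z i).length / 2)).flatMap
      (fun t => [(((shift G) ^ t) ω 0).1, (((shift G) ^ t) ω 0).2.2.1]) = (List.ofFn z).flatten}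

/-- The renovation condition for the words `z i`. -/
def Renovation [MeasurableSpace V] (P₀ : Measure (PalmSpace G)) (φ : MatchingPolicy G)
    {r : ℕ} (z : Fin r → List V) : Prop :=
  Tendsto (fun n : ℕ => P₀ (⋂ k : ℕ, ⋃ l ∈ Set.Iic n,
    emptyEvent φ l ∩ ((shift G) ^ k) '' emptyEvent φ (l + k) ∩
      ((shift G) ^ l) ⁻¹' wordEvent G z)) atTop (𝓝 1)

end MatchingModel

end

open MatchingModel

namespace MatchingModel

variable {V : Type*} {G : SimpleGraph V}

/-! The argument is a Loynes-type backward construction. An admissible word arriving in an empty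
system is stored entirely, so sub-additivity says that a run from a buffer `w` exceeds the run from
the empty buffer by at most `|w|`. A strong erasing word takes two items off any nonempty even
buffer (`StrongErasing.length_run_le`), so `r` of them clear an even buffer of length at most `2r`.

On the renovation event, the empty-started system of each past time `-k` is empty at some time `l ≤
n`, and the erasing words arrive next. By sub-additivity a system started at `-k` from at most `2r`
items still has at most `2r` items at time `l`, and the words empty it; the system started empty at
`0` is emptied too. From then on both see the same arrivals
(`run_arrivals_eq_of_mem_renovationEvent`). Shifting this event back to the past keeps its
probability, which tends to `1`, so contents at time `0` are a.s. eventually independent of the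
starting time (`ae_eventually_evenContent_eq`). Their common value is `limitContent`; it does not
depend on `r` or on the initial condition.

A solution need not be bounded, so uniqueness uses truncation: it couples with the limit unless its
length stays large along all remote shifts, which has small probability by stationarity
(`IsStationarySolution.ae_eq_of_coupling`). -/

theorem Queue.ext_val {w w' : Queue G} (h : w.1 = w'.1) : w = w' := Subtype.ext h

theorem Queue.eq_empty_of_length {w : Queue G} (h : w.length = 0) : w = Queue.empty G :=
  Queue.ext_val (List.length_eq_zero_iff.1 h)

@[simp] theorem Queue.length_empty : (Queue.empty G).length = 0 := rfl

/-! ### Buffer dynamics, sub-additivity and erasing words -/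

namespace MatchingPolicy

variable (φ : MatchingPolicy G)

/-- The queue detail after the arrivals of a list of items, from the queue detail `w`. -/
noncomputable def run (w : Queue G) (l : List (V × Prefs G)) : Queue G :=
  l.foldl (fun w p => φ.odot w p.1 p.2) w

/-- All preferences of a list of items can possibly be drawn. -/
def DrawableItems (l : List (V × Prefs G)) : Prop := ∀ p ∈ l, p.2 ∈ φ.prefLaw.support

variable {φ}

@[simp] theorem run_nil (w : Queue G) : φ.run w [] = w := rfl

@[simp] theorem run_cons (w : Queue G) (p : V × Prefs G) (l : List (V × Prefs G)) :
    φ.run w (p :: l) = φ.run (φ.odot w p.1 p.2) l := rfl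

theorem run_append (w : Queue G) (l l' : List (V × Prefs G)) :
    φ.run w (l ++ l') = φ.run (φ.run w l) l' := List.foldl_append

theorem run_empty_eq_Q (l : List (V × Prefs G)) :
    φ.run (Queue.empty G) l = φ.Q (l.map Prod.fst) (l.map Prod.snd) := by
  simp only [run, Q, List.zip_map', Prod.mk.eta, List.map_id']

theorem DrawableItems.drawable {l : List (V × Prefs G)} (h : φ.DrawableItems l) :
    φ.Drawable (l.map Prod.snd) := by
  intro σ hσ
  obtain ⟨p, hp, rfl⟩ := List.mem_map.1 hσ
  exact h p hp

theorem DrawableItems.append {l l' : List (V × Prefs G)} (h : φ.DrawableItems l)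
    (h' : φ.DrawableItems l') : φ.DrawableItems (l ++ l') := by
  intro p hp
  rcases List.mem_append.1 hp with hp | hp
  · exact h p hp
  · exact h' p hp

theorem even_length_odot (w : Queue G) (v : V) (σ : Prefs G) :
    Even (φ.odot w v σ).length ↔ ¬ Even w.length := by
  by_cases h : ∃ j ∈ w.1, G.Adj v j
  · have h1 : (φ.odot w v σ).length = (w.1.eraseIdx (φ.pos w v σ)).length :=
      congrArg Queue.length (dif_pos h)
    have h2 : (w.1.eraseIdx (φ.pos w v σ)).length + 1 = w.length :=
      List.length_eraseIdx_add_one (φ.pos_spec w v σ h).1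
    rw [h1, ← h2, Nat.even_add_one, not_not]
  · have h1 : (φ.odot w v σ).length = (w.1 ++ [v]).length := congrArg Queue.length (dif_neg h)
    rw [h1, List.length_append, List.length_singleton, Nat.even_add_one]
    rfl

theorem even_length_run (w : Queue G) (l : List (V × Prefs G)) :
    Even (φ.run w l).length ↔ (Even w.length ↔ Even l.length) := by
  induction l generalizing w with
  | nil => simp
  | cons p l ih =>
    rw [run_cons, ih, even_length_odot, List.length_cons, Nat.even_add_one]
    tauto

/-- An admissible word, arriving in an empty system, is stored entirely. -/
theorem run_empty_map_pair (σ : Prefs G) (w : Queue G) :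
    φ.run (Queue.empty G) (w.1.map fun v => (v, σ)) = w := by
  obtain ⟨w, hw⟩ := w
  induction w using List.reverseRecOn with
  | nil => rfl
  | append_singleton w v ih =>
    have hw' : ∀ i j, G.Adj i j → ¬ (i ∈ w ∧ j ∈ w) := fun i j hij h =>
      hw i j hij ⟨List.mem_append_left _ h.1, List.mem_append_left _ h.2⟩
    have hv : ¬ ∃ j ∈ w, G.Adj v j := fun ⟨j, hj, hvj⟩ => hw v j hvj (by simp [hj])
    have := ih hw'
    simp only at this ⊢
    rw [List.map_append, run_append, this]
    exact dif_neg hv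

theorem SubAdditive.length_run_append_le (h : φ.SubAdditive) {l l' : List (V × Prefs G)}
    (hl : φ.DrawableItems l) (hl' : φ.DrawableItems l') :
    (φ.run (Queue.empty G) (l ++ l')).length ≤
      (φ.run (Queue.empty G) l).length + (φ.run (Queue.empty G) l').length := by
  simp only [run_empty_eq_Q, List.map_append]
  exact h _ _ _ _ hl.drawable hl'.drawable (by simp) (by simp)

theorem drawableItems_map_pair {σ : Prefs G} (hσ : σ ∈ φ.prefLaw.support) (w : List V) :
    φ.DrawableItems (w.map fun v => (v, σ)) := by
  intro p hp
  obtain ⟨v, -, rfl⟩ := List.mem_map.1 hp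
  exact hσ

/-- Sub-additivity only concerns empty starts; it transfers to a start from `w` by letting `w`
itself arrive first, with any drawable preference. -/
theorem SubAdditive.length_run_le (h : φ.SubAdditive) (w : Queue G) {l : List (V × Prefs G)}
    (hl : φ.DrawableItems l) :
    (φ.run w l).length ≤ w.length + (φ.run (Queue.empty G) l).length := by
  obtain ⟨σ, hσ⟩ := φ.prefLaw.support_nonempty
  have := h.length_run_append_le (drawableItems_map_pair hσ w.1) hl
  rwa [run_append, run_empty_map_pair] at this

theorem StrongErasing.run_empty {z : List V} (hz : φ.StrongErasing z) {l : List (V × Prefs G)}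
    (hl : φ.DrawableItems l) (hlz : l.map Prod.fst = z) :
    φ.run (Queue.empty G) l = Queue.empty G := by
  rcases List.eq_nil_or_concat' l with rfl | ⟨l', p, rfl⟩
  · rfl
  · have := hz.2.2 0 (by simp [← hlz]) _ hl.drawable (by simp [← hlz])
    rwa [Nat.mul_zero, List.drop_zero, List.drop_zero, ← hlz, ← run_empty_eq_Q] at this

/-- A strong erasing word removes at least two items of a nonempty buffer of even content. -/
theorem StrongErasing.length_run_le {z : List V} (hz : φ.StrongErasing z) (hφ : φ.SubAdditive)
    {l : List (V × Prefs G)} (hl : φ.DrawableItems l) (hlz : l.map Prod.fst = z)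
    (w : Queue G) (hw : Even w.length) : (φ.run w l).length ≤ w.length - 2 := by
  rcases w with ⟨w, hadm⟩
  rcases List.eq_nil_or_concat' w with rfl | ⟨w₁, j, rfl⟩
  · have := hz.run_empty hl hlz
    exact (congrArg Queue.length this).le
  rcases List.eq_nil_or_concat' w₁ with rfl | ⟨w₂, i, rfl⟩
  · simp [Queue.length] at hw
  obtain ⟨σ, hσ⟩ := φ.prefLaw.support_nonempty
  have hw₂ : ∀ i j, G.Adj i j → ¬ (i ∈ w₂ ∧ j ∈ w₂) := fun i j hij h =>
    hadm i j hij ⟨by simp [h.1], by simp [h.2]⟩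
  have hij : ¬ G.Adj i j := fun h => hadm i j h (by simp)
  have hd : φ.Drawable [σ, σ] := by
    intro τ hτ
    simp only [List.mem_cons, List.not_mem_nil, or_false, or_self] at hτ
    exact hτ ▸ hσ
  have h1 := hz.2.1 i j hij [σ, σ] (l.map Prod.snd) hd hl.drawable rfl (by simp [← hlz])
  have h2 : φ.run (Queue.empty G) ([(i, σ), (j, σ)] ++ l) = Queue.empty G := by
    rw [run_empty_eq_Q, ← h1, ← hlz]
    rfl
  -- Split the arrivals `w₂ i j z` before the last two stored items: by clause (1) the part `i j z`
  -- contributes nothing, leaving `|w₂| = |w| - 2`.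
  have h3 := hφ.length_run_append_le (drawableItems_map_pair hσ w₂)
    ((drawableItems_map_pair hσ [i, j]).append hl)
  have h4 := run_empty_map_pair (φ := φ) σ ⟨w₂, hw₂⟩
  have h5 := run_empty_map_pair (φ := φ) σ ⟨w₂ ++ [i] ++ [j], hadm⟩
  simp only [List.map_cons, List.map_nil] at h3 h4 h5
  rw [h2, h4, ← List.append_assoc, run_append,
    show (w₂.map (fun v => (v, σ)) ++ [(i, σ), (j, σ)])
      = (w₂ ++ [i] ++ [j]).map (fun v => (v, σ)) by simp, h5] at h3
  rw [Queue.length_empty] at h3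
  simpa [Queue.length] using h3

theorem length_run_flatten_le (hφ : φ.SubAdditive) (zs : List (List V))
    (hzs : ∀ z ∈ zs, φ.StrongErasing z) {l : List (V × Prefs G)} (hl : φ.DrawableItems l)
    (hlz : l.map Prod.fst = zs.flatten) (w : Queue G) (hw : Even w.length) :
    (φ.run w l).length ≤ w.length - 2 * zs.length := by
  induction zs generalizing l w with
  | nil =>
    have : l = [] := by simpa using hlz
    simp [this]
  | cons z zs ih =>
    rw [List.flatten_cons, List.map_eq_append_iff] at hlz
    obtain ⟨l₁, l₂, rfl, h₁, h₂⟩ := hlz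
    have hl₁ : φ.DrawableItems l₁ := fun p hp => hl p (List.mem_append_left _ hp)
    have hl₂ : φ.DrawableItems l₂ := fun p hp => hl p (List.mem_append_right _ hp)
    have hz := hzs z (by simp)
    have h3 := hz.length_run_le hφ hl₁ h₁ w hw
    have h4 : Even l₁.length := by
      have := hz.1
      rwa [← h₁, List.length_map] at this
    -- Two-item removal needs an even buffer, and an erasing word preserves parity.
    have h5 := ih (fun z hz => hzs z (by simp [hz])) hl₂ h₂ (φ.run w l₁)
      ((even_length_run w l₁).2 (by tauto))
    rw [run_append, List.length_cons]
    omega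

end MatchingPolicy

/-! ### Arrivals along a trajectory and the shift -/

/-- The items arriving at the (even) times `0, …, n - 1`. -/
def arrivals (ω : PalmSpace G) (n : ℕ) : List (V × Prefs G) :=
  (List.range n).flatMap fun t =>
    [((((shift G) ^ t) ω 0).1, (((shift G) ^ t) ω 0).2.1),
      ((((shift G) ^ t) ω 0).2.2.1, (((shift G) ^ t) ω 0).2.2.2)]

theorem arrivals_add (ω : PalmSpace G) (m n : ℕ) :
    arrivals ω (m + n) = arrivals ω m ++ arrivals (((shift G) ^ m) ω) n := by
  simp only [arrivals, List.range_add, List.flatMap_append, List.flatMap_map]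
  congr 2
  funext t
  rw [← Equiv.Perm.mul_apply, ← pow_add, add_comm]

theorem map_fst_arrivals (ω : PalmSpace G) (n : ℕ) :
    (arrivals ω n).map Prod.fst = (List.range n).flatMap
      (fun t => [(((shift G) ^ t) ω 0).1, (((shift G) ^ t) ω 0).2.2.1]) := by
  simp [arrivals, List.map_flatMap]

theorem even_length_arrivals (ω : PalmSpace G) (n : ℕ) : Even (arrivals ω n).length := by
  simp [arrivals, List.length_flatMap]

theorem evenContent_eq_run (φ : MatchingPolicy G) (Y : PalmSpace G → Queue G) (n : ℕ)
    (ω : PalmSpace G) : evenContent φ Y n ω = φ.run (Y ω) (arrivals ω n) := by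
  induction n with
  | zero => simp [evenContent, arrivals]
  | succ n ih =>
    rw [evenContent, ih, arrivals_add, MatchingPolicy.run_append]
    rfl

theorem even_length_evenContent (φ : MatchingPolicy G) {Y : PalmSpace G → Queue G} (n : ℕ)
    {ω : PalmSpace G} (hY : Even (Y ω).length) : Even (evenContent φ Y n ω).length := by
  rw [evenContent_eq_run, MatchingPolicy.even_length_run]
  simp [hY, even_length_arrivals]

theorem shift_zpow_apply (k : ℤ) (ω : PalmSpace G) (n : ℤ) :
    ((shift G) ^ k) ω n = ω (n + k) := by
  induction k generalizing ω n with
  | zero => simp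
  | succ k ih =>
    rw [zpow_add_one, Equiv.Perm.mul_apply, ih]
    exact congrArg ω (by ring)
  | pred k ih =>
    rw [zpow_sub_one, Equiv.Perm.mul_apply, ih]
    exact congrArg ω (by ring)

theorem shift_pow_apply (k : ℕ) (ω : PalmSpace G) (n : ℤ) :
    ((shift G) ^ k) ω n = ω (n + k) := by
  rw [← zpow_natCast, shift_zpow_apply]

theorem shift_pow_symm_apply (k : ℕ) (ω : PalmSpace G) (n : ℤ) :
    ((shift G) ^ k).symm ω n = ω (n - k) := by
  rw [← Equiv.Perm.inv_def, ← zpow_natCast, ← zpow_neg, shift_zpow_apply, sub_eq_add_neg]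

/-- All preferences of a trajectory can possibly be drawn. -/
def DrawablePath (φ : MatchingPolicy G) (ω : PalmSpace G) : Prop :=
  ∀ n, (ω n).2.1 ∈ φ.prefLaw.support ∧ (ω n).2.2.2 ∈ φ.prefLaw.support

theorem DrawablePath.arrivals {φ : MatchingPolicy G} {ω : PalmSpace G} (h : DrawablePath φ ω)
    (n : ℕ) : φ.DrawableItems (arrivals ω n) := by
  intro p hp
  simp only [MatchingModel.arrivals, List.mem_flatMap, List.mem_cons, List.not_mem_nil,
    or_false, shift_pow_apply] at hp
  obtain ⟨t, -, rfl | rfl⟩ := hp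
  · exact (h _).1
  · exact (h _).2

theorem DrawablePath.shift_pow {φ : MatchingPolicy G} {ω : PalmSpace G} (h : DrawablePath φ ω)
    (k : ℕ) : DrawablePath φ (((shift G) ^ k) ω) := by
  intro n
  rw [shift_pow_apply]
  exact h _

theorem DrawablePath.shift_pow_symm {φ : MatchingPolicy G} {ω : PalmSpace G}
    (h : DrawablePath φ ω) (k : ℕ) : DrawablePath φ (((shift G) ^ k).symm ω) := by
  intro n
  rw [shift_pow_symm_apply]
  exact h _

/-! ### Renovation: merging of trajectories -/

/-- The event that, up to time `n`, every system started empty in the past meets, when both are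
empty, the system started empty at time `0`, the next arrivals spelling the words `z i`. -/
def renovationEvent (φ : MatchingPolicy G) {r : ℕ} (z : Fin r → List V) (n : ℕ) :
    Set (PalmSpace G) :=
  ⋂ k : ℕ, ⋃ l ∈ Set.Iic n, emptyEvent φ l ∩ ((shift G) ^ k) '' emptyEvent φ (l + k) ∩
    ((shift G) ^ l) ⁻¹' wordEvent G z

/-- At time `l` the buffer has at most `|w| ≤ 2r` items, because the empty-started system is empty
then; the `r` erasing words that follow remove them all. -/
theorem run_arrivals_eq_empty {φ : MatchingPolicy G} (hφ : φ.SubAdditive) {r : ℕ}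
    {z : Fin r → List V} (hz : ∀ i, φ.StrongErasing (z i)) {ω : PalmSpace G}
    (hω : DrawablePath φ ω) {l : ℕ} (hl : ω ∈ emptyEvent φ l)
    (hw : ((shift G) ^ l) ω ∈ wordEvent G z) (w : Queue G) (hwe : Even w.length)
    (hwr : w.length ≤ 2 * r) :
    φ.run w (arrivals ω (l + ∑ i, (z i).length / 2)) = Queue.empty G := by
  rw [arrivals_add, MatchingPolicy.run_append]
  have h1 := hφ.length_run_le w (hω.arrivals l)
  have h2 : φ.run (Queue.empty G) (arrivals ω l) = Queue.empty G := by
    have h := evenContent_eq_run φ (fun _ => Queue.empty G) l ω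
    exact h.symm.trans hl
  rw [h2, Queue.length_empty] at h1
  have h3 := MatchingPolicy.length_run_flatten_le hφ (List.ofFn z)
    (by simpa [List.mem_ofFn] using hz) ((hω.shift_pow l).arrivals _)
    ((map_fst_arrivals _ _).trans hw) (φ.run w (arrivals ω l))
    ((MatchingPolicy.even_length_run _ _).2 (by simp [hwe, even_length_arrivals]))
  rw [List.length_ofFn] at h3
  exact Queue.eq_empty_of_length (by omega)

theorem run_arrivals_eq_of_mem_renovationEvent {φ : MatchingPolicy G} (hφ : φ.SubAdditive)
    {r : ℕ} {z : Fin r → List V} (hz : ∀ i, φ.StrongErasing (z i)) {ω : PalmSpace G}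
    (hω : DrawablePath φ ω) {n : ℕ} (hn : ω ∈ renovationEvent φ z n) (k : ℕ) (w : Queue G)
    (hwe : Even w.length) (hwr : w.length ≤ 2 * r) :
    φ.run w (arrivals (((shift G) ^ k).symm ω) (k + (n + ∑ i, (z i).length / 2))) =
      φ.run (Queue.empty G) (arrivals ω (n + ∑ i, (z i).length / 2)) := by
  obtain ⟨l, hln, ⟨h0, h1⟩, h2⟩ := Set.mem_iUnion₂.1 (Set.mem_iInter.1 hn k)
  -- The renovation time `l` depends on `k`; the slack `d = n - l` is absorbed by arrivals common to
  -- both systems, both being empty after the erasing words.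
  obtain ⟨d, rfl⟩ := Nat.exists_eq_add_of_le (Set.mem_Iic.1 hln)
  rw [Equiv.image_eq_preimage_symm] at h1
  have hs : ∀ j, ((shift G) ^ (j + k)) (((shift G) ^ k).symm ω) = ((shift G) ^ j) ω := by
    intro j
    rw [pow_add, Equiv.Perm.mul_apply, Equiv.apply_symm_apply]
  have h3 := run_arrivals_eq_empty hφ hz (hω.shift_pow_symm k) h1
    (by rw [hs]; exact h2) w hwe hwr
  have h4 := run_arrivals_eq_empty hφ hz hω h0 h2 (Queue.empty G) (by simp) (by simp)
  rw [show k + (l + d + ∑ i, (z i).length / 2) = l + k + ∑ i, (z i).length / 2 + d by ring,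
    show l + d + ∑ i, (z i).length / 2 = l + ∑ i, (z i).length / 2 + d by ring,
    arrivals_add _ _ d, arrivals_add _ _ d, MatchingPolicy.run_append,
    MatchingPolicy.run_append, h3, h4,
    show l + k + ∑ i, (z i).length / 2 = l + ∑ i, (z i).length / 2 + k by ring, hs]

theorem evenContent_succ_shift (φ : MatchingPolicy G) (Y : PalmSpace G → Queue G) (n : ℕ)
    (ω : PalmSpace G) :
    evenContent φ Y (n + 1) (((shift G) ^ (n + 1)).symm (shift G ω)) =
      evenStep φ (evenContent φ Y n (((shift G) ^ n).symm ω)) (ω 0) := by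
  have h : ((shift G) ^ (n + 1)).symm (shift G ω) = ((shift G) ^ n).symm ω := by
    rw [Equiv.symm_apply_eq, pow_succ', Equiv.Perm.mul_apply, Equiv.apply_symm_apply]
  rw [h, evenContent, Equiv.apply_symm_apply]

/-! ### The backward limit -/

open Classical in
/-- The eventual content at time `0` of the systems started empty in the remote past. -/
noncomputable def limitContent (φ : MatchingPolicy G) (ω : PalmSpace G) : Queue G :=
  if h : ∃ w, ∃ N : ℕ, ∀ n ≥ N,
      evenContent φ (fun _ => Queue.empty G) n (((shift G) ^ n).symm ω) = w
  then h.choose else Queue.empty G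

theorem limitContent_eq {φ : MatchingPolicy G} {ω : PalmSpace G} {w : Queue G}
    (h : ∃ N : ℕ, ∀ n ≥ N,
      evenContent φ (fun _ => Queue.empty G) n (((shift G) ^ n).symm ω) = w) :
    limitContent φ ω = w := by
  have h' : ∃ w, ∃ N : ℕ, ∀ n ≥ N,
      evenContent φ (fun _ => Queue.empty G) n (((shift G) ^ n).symm ω) = w := ⟨w, h⟩
  rw [limitContent, dif_pos h']
  obtain ⟨N, hN⟩ := h
  obtain ⟨M, hM⟩ := h'.choose_spec
  rw [← hM (max M N) (le_max_left _ _), hN _ (le_max_right _ _)]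

/-! ### Measurability, invariance and uniqueness -/

section Countability

variable [Finite V]

instance : Countable (Queue G) := by
  unfold Queue
  infer_instance

instance : Countable (Prefs G) := by
  classical
  have : Finite (Prefs G) := by
    unfold Prefs
    infer_instance
  infer_instance

end Countability

instance : DiscreteMeasurableSpace (Queue G) := ⟨fun _ => trivial⟩

instance : DiscreteMeasurableSpace (Prefs G) := ⟨fun _ => trivial⟩

variable [MeasurableSpace V]

theorem measurable_shift_pow_symm (k : ℕ) : Measurable ((shift G) ^ k).symm := by
  refine measurable_pi_lambda _ fun n => ?_
  simp only [shift_pow_symm_apply]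
  exact measurable_pi_apply _

theorem measurable_shift_pow (k : ℕ) : Measurable ((shift G) ^ k) := by
  refine measurable_pi_lambda _ fun n => ?_
  simp only [shift_pow_apply]
  exact measurable_pi_apply _

/-- The shift is a measurable equivalence, so no measurability of `s` is needed; this is what allows
it to be applied to renovation events directly. -/
theorem measure_shift_pow_symm_preimage {P₀ : Measure (PalmSpace G)}
    (h : MeasurePreserving (shift G) P₀ P₀) (k : ℕ) (s : Set (PalmSpace G)) :
    P₀ (((shift G) ^ k).symm ⁻¹' s) = P₀ s := by
  let e : PalmSpace G ≃ᵐ PalmSpace G :=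
    ⟨(shift G) ^ k, measurable_shift_pow k, measurable_shift_pow_symm k⟩
  have he : MeasurePreserving e P₀ P₀ := by
    have := h.iterate k
    rwa [Equiv.Perm.iterate_eq_pow] at this
  exact (he.symm e).measure_preimage_equiv s

theorem ae_shift_pow_symm {P₀ : Measure (PalmSpace G)}
    (h : MeasurePreserving (shift G) P₀ P₀) (k : ℕ) {p : PalmSpace G → Prop}
    (hp : ∀ᵐ ω ∂P₀, p ω) : ∀ᵐ ω ∂P₀, p (((shift G) ^ k).symm ω) := by
  rw [ae_iff] at hp ⊢
  exact (measure_shift_pow_symm_preimage h k _).trans hp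

theorem IsStationarySolution.ae_evenContent_eq {P₀ : Measure (PalmSpace G)}
    {φ : MatchingPolicy G} (hP : MeasurePreserving (shift G) P₀ P₀) {U : PalmSpace G → Queue G}
    (hU : IsStationarySolution P₀ φ U) :
    ∀ᵐ ω ∂P₀, ∀ n : ℕ, evenContent φ U n (((shift G) ^ n).symm ω) = U ω := by
  have h : ∀ᵐ ω ∂P₀, ∀ k : ℕ, U (shift G (((shift G) ^ k).symm ω)) =
      evenStep φ (U (((shift G) ^ k).symm ω)) ((((shift G) ^ k).symm ω) 0) :=
    ae_all_iff.2 fun k => ae_shift_pow_symm hP k hU.2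
  filter_upwards [h] with ω hω n
  have key : ∀ j ≤ n, evenContent φ U j (((shift G) ^ n).symm ω) =
      U (((shift G) ^ j) (((shift G) ^ n).symm ω)) := by
    intro j hj
    induction j with
    | zero => rfl
    | succ j ih =>
      obtain ⟨d, rfl⟩ := Nat.exists_eq_add_of_le hj
      have hd : ((shift G) ^ j) (((shift G) ^ (j + 1 + d)).symm ω)
          = ((shift G) ^ (d + 1)).symm ω := by
        rw [Equiv.eq_symm_apply, ← Equiv.Perm.mul_apply, ← pow_add,
          show d + 1 + j = j + 1 + d by ring, Equiv.apply_symm_apply]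
      rw [evenContent, ih (by omega), pow_succ', Equiv.Perm.mul_apply, hd, hω (d + 1)]
  simpa using key n le_rfl

theorem IsStationarySolution.ae_eq_of_coupling {P₀ : Measure (PalmSpace G)}
    [IsProbabilityMeasure P₀] {φ : MatchingPolicy G} (hP : MeasurePreserving (shift G) P₀ P₀)
    {U U' : PalmSpace G → Queue G}
    (hcoup : ∀ Y : PalmSpace G → Queue G, IsBoundedEvenRV P₀ Y →
      StrongBackwardsCoupling P₀ φ Y U)
    (hU' : IsStationarySolution P₀ φ U') : U' =ᵐ[P₀] U := by
  classical
  have hmeasC : ∀ r : ℕ, MeasurableSet {ω | 2 * r < (U' ω).length} := fun r =>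
    hU'.1.1 (MeasurableSet.of_discrete (s := {w : Queue G | 2 * r < w.length}))
  have hle : ∀ r : ℕ, P₀ {ω | U' ω ≠ U ω} ≤ P₀ {ω | 2 * (r + 1) < (U' ω).length} := by
    intro r
    -- Truncation of `U'`; the level `r + 1` rather than `r` meets the requirement of a positive
    -- bound.
    set Y : PalmSpace G → Queue G := fun ω =>
      if 2 * (r + 1) < (U' ω).length then Queue.empty G else U' ω with hYdef
    have hY : IsBoundedEvenRV P₀ Y := by
      refine ⟨⟨Measurable.ite (hmeasC (r + 1)) measurable_const hU'.1.1, fun ω => ?_⟩,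
        r + 1, by omega, Eventually.of_forall fun ω => ?_⟩
      · simp only [hYdef]
        split_ifs
        · simp [evenQueues]
        · exact hU'.1.2 ω
      · simp only [hYdef]
        split_ifs with h
        · simp
        · omega
    -- Whenever `U'` is below the level at time `-n`, starting from `Y` or from `U'` at that time
    -- gives the same content at time `0`. For large `n` the former is `U`, and the latter is always
    -- `U'`.
    have hsub : {ω | U' ω ≠ U ω} ≤ᵐ[P₀] ⋃ N : ℕ, ⋂ n : ℕ, ⋂ _ : N ≤ n,
        ((shift G) ^ n).symm ⁻¹' {ω | 2 * (r + 1) < (U' ω).length} := by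
      filter_upwards [hcoup Y hY, hU'.ae_evenContent_eq hP] with ω h1 h2 hne
      obtain ⟨N, hN⟩ := h1
      refine Set.mem_iUnion.2 ⟨N, Set.mem_iInter₂.2 fun n hn => ?_⟩
      by_contra hlt
      refine hne ?_
      rw [← hN n hn, ← h2 n, evenContent_eq_run, evenContent_eq_run]
      exact congrArg (fun w => φ.run w _) (if_neg hlt).symm
    refine (measure_mono_ae hsub).trans ?_
    have hmono : Monotone fun N : ℕ => ⋂ n : ℕ, ⋂ _ : N ≤ n,
        ((shift G) ^ n).symm ⁻¹' {ω | 2 * (r + 1) < (U' ω).length} :=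
      fun a b hab => Set.iInter_mono fun n => Set.iInter_mono' fun hb => ⟨hab.trans hb, le_rfl⟩
    rw [hmono.measure_iUnion]
    refine iSup_le fun N => ?_
    -- Each intersection lies in its `N`-th term, whose measure is independent of `N` by invariance.
    rw [← measure_shift_pow_symm_preimage hP N {ω | 2 * (r + 1) < (U' ω).length}]
    exact measure_mono (Set.iInter₂_subset N le_rfl)
  have hlim : Tendsto (fun r : ℕ => P₀ {ω | 2 * (r + 1) < (U' ω).length}) atTop (𝓝 0) := by
    have hemp : ⋂ r : ℕ, {ω | 2 * (r + 1) < (U' ω).length} = ∅ := by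
      refine Set.eq_empty_of_forall_notMem fun ω hω => ?_
      have := Set.mem_iInter.1 hω (U' ω).length
      simp only [Set.mem_ofPred_eq] at this
      omega
    rw [← measure_empty (μ := P₀), ← hemp]
    refine tendsto_measure_iInter_atTop (fun r => (hmeasC (r + 1)).nullMeasurableSet) ?_
      ⟨0, measure_ne_top _ _⟩
    intro a b hab ω hω
    simp only [Set.mem_ofPred_eq] at hω ⊢
    omega
  exact le_antisymm (ge_of_tendsto' hlim hle) bot_le

/-! ### Almost sure coupling and measurability of the limit -/

variable [Finite V] [MeasurableSingletonClass V]

theorem measurable_evenContent (φ : MatchingPolicy G) {Y : PalmSpace G → Queue G}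
    (hY : Measurable Y) (n : ℕ) : Measurable (evenContent φ Y n) := by
  induction n with
  | zero => exact hY
  | succ n ih =>
    have h1 : Measurable (fun p : Queue G × PairInput G => evenStep φ p.1 p.2) :=
      Measurable.of_discrete
    exact h1.comp (ih.prodMk ((measurable_pi_apply 0).comp (measurable_shift_pow n)))

theorem ae_drawablePath {Ω : Type*} [MeasurableSpace Ω] {P : Measure Ω} {φ : MatchingPolicy G}
    {μ₀ μ₁ : PMF V} {C : ℤ → Ω → V} {S : ℤ → Ω → Prefs G}
    (h : StationaryErgodicInput P φ μ₀ μ₁ C S) :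
    ∀ᵐ ω ∂palmLaw P C S, DrawablePath φ ω := by
  have hS : ∀ᵐ x ∂P, ∀ n, S n x ∈ φ.prefLaw.support := by
    refine ae_all_iff.2 fun n => ?_
    have h1 : ∀ᵐ σ ∂(P.map (S n)), σ ∈ φ.prefLaw.support := by
      rw [h.law_pref, ae_iff, PMF.toMeasure_apply_eq_zero_iff _ MeasurableSet.of_discrete]
      exact Set.disjoint_left.2 fun σ h1 h2 => h2 h1
    exact ae_of_ae_map (h.measurable_pref n).aemeasurable h1
  have hm : Measurable (pairInput C S) := measurable_pi_lambda _ fun n =>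
    (h.measurable_class _).prodMk ((h.measurable_pref _).prodMk
      ((h.measurable_class _).prodMk (h.measurable_pref _)))
  have hd : MeasurableSet {ω : PalmSpace G | DrawablePath φ ω} := by
    have : {ω : PalmSpace G | DrawablePath φ ω} = ⋂ n : ℤ, (fun ω : PalmSpace G => ω n) ⁻¹'
        {x | x.2.1 ∈ φ.prefLaw.support ∧ x.2.2.2 ∈ φ.prefLaw.support} := by
      ext ω
      simp [DrawablePath]
    rw [this]
    exact MeasurableSet.iInter fun n => measurable_pi_apply n MeasurableSet.of_discrete
  refine (ae_map_iff hm.aemeasurable hd).2 ?_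
  filter_upwards [hS] with x hx n
  exact ⟨hx _, hx _⟩

/-- Under the renovation condition, the systems started from `Y` and from the empty buffer in the
remote past coincide at time `0`, and do not depend on the starting time. -/
theorem ae_eventually_evenContent_eq {P₀ : Measure (PalmSpace G)} [IsProbabilityMeasure P₀]
    {φ : MatchingPolicy G} (hP : MeasurePreserving (shift G) P₀ P₀)
    (hD : ∀ᵐ ω ∂P₀, DrawablePath φ ω) (hφ : φ.SubAdditive) {r : ℕ} {z : Fin r → List V}
    (hz : ∀ i, φ.StrongErasing (z i)) (hR : Renovation P₀ φ z) {Y : PalmSpace G → Queue G}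
    (hY : IsEvenRV Y) (hYr : ∀ᵐ ω ∂P₀, (Y ω).length ≤ 2 * r) :
    ∀ᵐ ω ∂P₀, ∃ N : ℕ, ∀ n ≥ N,
      evenContent φ Y n (((shift G) ^ n).symm ω) =
        evenContent φ (fun _ => Queue.empty G) N (((shift G) ^ N).symm ω) ∧
      evenContent φ (fun _ => Queue.empty G) n (((shift G) ^ n).symm ω) =
        evenContent φ (fun _ => Queue.empty G) N (((shift G) ^ N).symm ω) := by
  have hmeas : ∀ {Y : PalmSpace G → Queue G}, Measurable Y → ∀ n,
      Measurable fun ω => evenContent φ Y n (((shift G) ^ n).symm ω) := fun hY n =>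
    (measurable_evenContent φ hY n).comp (measurable_shift_pow_symm n)
  set s : Set (PalmSpace G) := {ω | ∃ N : ℕ, ∀ n ≥ N,
      evenContent φ Y n (((shift G) ^ n).symm ω) =
        evenContent φ (fun _ => Queue.empty G) N (((shift G) ^ N).symm ω) ∧
      evenContent φ (fun _ => Queue.empty G) n (((shift G) ^ n).symm ω) =
        evenContent φ (fun _ => Queue.empty G) N (((shift G) ^ N).symm ω)} with hs
  have hsm : MeasurableSet s := by
    have : s = ⋃ N : ℕ, ⋂ n : ℕ, ⋂ _ : n ≥ N,
      {ω | evenContent φ Y n (((shift G) ^ n).symm ω) =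
        evenContent φ (fun _ => Queue.empty G) N (((shift G) ^ N).symm ω)} ∩
      {ω | evenContent φ (fun _ => Queue.empty G) n (((shift G) ^ n).symm ω) =
        evenContent φ (fun _ => Queue.empty G) N (((shift G) ^ N).symm ω)} := by
      ext ω
      simp only [hs, Set.mem_ofPred_eq, Set.mem_iUnion, Set.mem_iInter, Set.mem_inter_iff]
    rw [this]
    exact MeasurableSet.iUnion fun N => MeasurableSet.iInter fun n => MeasurableSet.iInter fun _ =>
      (measurableSet_eq_fun (hmeas hY.1 n) (hmeas measurable_const N)).inter
        (measurableSet_eq_fun (hmeas measurable_const n) (hmeas measurable_const N))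
  have hle : ∀ n, P₀ (renovationEvent φ z n) ≤ P₀ s := by
    intro n
    set N := n + ∑ i, (z i).length / 2 with hN
    -- Placing the renovation window on the times `-N, …, -1` makes the merging complete by time
    -- `0`, for every start at `-(k + N)`.
    rw [← measure_shift_pow_symm_preimage hP N]
    refine measure_mono_ae ?_
    filter_upwards [hD, ae_all_iff.2 fun k => ae_shift_pow_symm hP k hYr] with ω hω hYω hmem
    refine ⟨N, fun j hj => ?_⟩
    obtain ⟨k, rfl⟩ := Nat.exists_eq_add_of_le' hj
    have hsym : ((shift G) ^ k).symm (((shift G) ^ N).symm ω) = ((shift G) ^ (k + N)).symm ω := by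
      funext i
      simp only [shift_pow_symm_apply]
      exact congrArg ω (by push_cast; ring)
    have key := run_arrivals_eq_of_mem_renovationEvent hφ hz (hω.shift_pow_symm N) hmem k
    rw [hsym, ← hN] at key
    simp only [evenContent_eq_run]
    exact ⟨key _ (hY.2 _) (hYω _), key _ (by simp) (by simp)⟩
  have h1 : (1 : ENNReal) ≤ P₀ s := le_of_tendsto' hR hle
  exact (prob_compl_eq_zero_iff hsm).2 (le_antisymm prob_le_one h1)

theorem isEvenRV_limitContent (φ : MatchingPolicy G) : IsEvenRV (limitContent φ) := by
  classical
  constructor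
  · have hm : ∀ w, MeasurableSet {ω | ∃ N : ℕ, ∀ n ≥ N,
        evenContent φ (fun _ => Queue.empty G) n (((shift G) ^ n).symm ω) = w} := by
      intro w
      simp only [Set.ofPred_exists, Set.ofPred_forall]
      exact MeasurableSet.iUnion fun N => MeasurableSet.iInter fun n =>
        MeasurableSet.iInter fun _ => ((measurable_evenContent φ measurable_const n).comp
          (measurable_shift_pow_symm n)) (MeasurableSet.singleton w)
    refine measurable_to_countable' fun w => ?_
    -- The second set accounts for the default value, taken where no limit exists; it is empty or
    -- everything off the limit set according to `w`.
    have h1 : limitContent φ ⁻¹' {w} = {ω | ∃ N : ℕ, ∀ n ≥ N,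
        evenContent φ (fun _ => Queue.empty G) n (((shift G) ^ n).symm ω) = w} ∪
        ({ω | ∃ w, ∃ N : ℕ, ∀ n ≥ N,
          evenContent φ (fun _ => Queue.empty G) n (((shift G) ^ n).symm ω) = w}ᶜ ∩
          {_ω | Queue.empty G = w}) := by
      ext ω
      by_cases h : ∃ w, ∃ N : ℕ, ∀ n ≥ N,
          evenContent φ (fun _ => Queue.empty G) n (((shift G) ^ n).symm ω) = w
      · obtain ⟨w', hw'⟩ := h
        constructor
        · intro hω
          left
          have := limitContent_eq hw'
          rw [Set.mem_preimage, Set.mem_singleton_iff] at hω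
          rw [← hω, this]
          exact hw'
        · rintro (hω | hω)
          · exact limitContent_eq hω
          · exact absurd ⟨w', hw'⟩ hω.1
      · have h2 : limitContent φ ω = Queue.empty G := dif_neg h
        constructor
        · intro hω
          exact Or.inr ⟨h, h2.symm.trans hω⟩
        · rintro (hω | hω)
          · exact absurd ⟨w, hω⟩ h
          · exact h2.trans hω.2
    rw [h1]
    refine (hm w).union (MeasurableSet.inter (MeasurableSet.compl ?_) (MeasurableSet.const _))
    rw [Set.ofPred_exists]
    exact MeasurableSet.iUnion hm
  · intro ω
    by_cases h : ∃ w, ∃ N : ℕ, ∀ n ≥ N,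
        evenContent φ (fun _ => Queue.empty G) n (((shift G) ^ n).symm ω) = w
    · obtain ⟨w, N, hN⟩ := h
      rw [limitContent_eq ⟨N, hN⟩, ← hN N le_rfl]
      exact even_length_evenContent φ N (by simp)
    · rw [limitContent, dif_neg h]
      simp [evenQueues]

end MatchingModel

open MatchingModel
theorem mainTheorem5 {V : Type*} [Fintype V] [MeasurableSpace V] [MeasurableSingletonClass V]
    (G : SimpleGraph V) (_hG : G.Connected) (φ : MatchingPolicy G)
    {Ω : Type*} [MeasurableSpace Ω] (P : Measure Ω) [IsProbabilityMeasure P]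
    (μ₀ μ₁ : PMF V) (C : ℤ → Ω → V) (S : ℤ → Ω → Prefs G)
    (_hInput : StationaryErgodicInput P φ μ₀ μ₁ C S)
    (_hSub : φ.SubAdditive)
    (_hErase : ∃ z : List V, φ.StrongErasing z)
    (_hRenov : ∀ r : ℕ, 1 ≤ r → ∃ z : Fin r → List V,
      (∀ i, φ.StrongErasing (z i)) ∧ Renovation (palmLaw P C S) φ z) :
    ∃ U : PalmSpace G → Queue G,
      IsStationarySolution (palmLaw P C S) φ U ∧
      (∀ U' : PalmSpace G → Queue G, IsStationarySolution (palmLaw P C S) φ U' →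
        U' =ᵐ[palmLaw P C S] U) ∧
      ∀ Y : PalmSpace G → Queue G, IsBoundedEvenRV (palmLaw P C S) Y →
        StrongBackwardsCoupling (palmLaw P C S) φ Y U := by
  have hm : Measurable (pairInput C S) := measurable_pi_lambda _ fun n =>
    (_hInput.measurable_class _).prodMk ((_hInput.measurable_pref _).prodMk
      ((_hInput.measurable_class _).prodMk (_hInput.measurable_pref _)))
  have : IsProbabilityMeasure (palmLaw P C S) := Measure.isProbabilityMeasure_map hm.aemeasurable
  have hP := _hInput.ergodic.toMeasurePreserving
  have hD := ae_drawablePath _hInput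
  have hcoup : ∀ Y : PalmSpace G → Queue G, IsBoundedEvenRV (palmLaw P C S) Y →
      StrongBackwardsCoupling (palmLaw P C S) φ Y (limitContent φ) := by
    rintro Y ⟨hY, r, hr, hYr⟩
    obtain ⟨z, hz, hR⟩ := _hRenov r hr
    filter_upwards [ae_eventually_evenContent_eq hP hD _hSub hz hR hY hYr] with ω ⟨N, hN⟩
    exact ⟨N, fun n hn => (hN n hn).1.trans
      (limitContent_eq ⟨N, fun j hj => (hN j hj).2⟩).symm⟩
  refine ⟨limitContent φ, ⟨isEvenRV_limitContent φ, ?_⟩,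
    fun U' hU' => hU'.ae_eq_of_coupling hP hcoup, hcoup⟩
  have hempty : IsBoundedEvenRV (palmLaw P C S) (fun _ : PalmSpace G => Queue.empty G) :=
    ⟨⟨measurable_const, fun _ => by simp [evenQueues]⟩, 1, le_rfl,
      Eventually.of_forall fun _ => by simp⟩
  filter_upwards [hcoup _ hempty] with ω ⟨N, hN⟩
  -- Seen from the shifted trajectory, a start `n + 1` steps back is a start `n` steps back for `ω`
  -- followed by one more step, so the stabilisation index grows by one.
  refine limitContent_eq ⟨N + 1, fun n hn => ?_⟩
  obtain ⟨d, rfl⟩ := Nat.exists_eq_add_of_le' (show 1 ≤ n by omega)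
  rw [evenContent_succ_shift, hN d (by omega)]
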